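/- **Setting.** Graphs are finite, simple and undirected, with vertex set $V=\{1,\dots,n\}$. Two graphs on $V$ are *edge-neighboring* if they differ in exactly one edge. The *$k$-core* of $G$ is its maximal induced subgraph of minimum degree at least $k$; the *core number* $k(v)$ is the largest $k$ such that $v$ lies in the $k$-core. Values $\hat k(v)$ are *$(\phi,\zeta)$-approximate core numbers* if $k(v)-\zeta\le \hat k(v)\le \phi\,k(v)+\zeta$ for all $v\in V$. $\mathrm{Lap}(b)$ is the distribution on $\mathbb R$ with density $\frac1{2b}e^{-|x|/b}$. **Local model.** Each node knows only its set of neighbors and private randomness of its own (independent of that of the other nodes), which it keeps during the whole computation. In each round a curator who sees only the public transcript announces which nodes are queried, a randomizer for each of them (a function of its neighborhood and its private randomness) and privacy parameters; the queried nodes' outputs become public; or the curator stops. The transcript consists of all announcements and outputs; its length is the number of rounds. The protocol is *$\varepsilon$-local edge differentially private* if every announced randomizer is a differentially private function of the node's neighborhood (with respect to changing one neighbor) for its announced parameter, and $\Pr[\text{transcript on }G\in E]\le e^{\varepsilon}\Pr[\text{transcript on }G'\in E]$ for all edge-neighboring $G,G'$ and all events $E$. **Algorithm** (parameters $\varepsilon>0$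 and $\eta_0>0$). Let $\psi=0.1\,\eta_0$, $\lambda=\frac{2(30-\eta_0)\eta_0}{(\eta_0+10)^2}$ and $g=4\lceil\log_{1+\psi}n\rceil$. Each node $i$ draws $\tilde\ell(i)\sim\mathrm{Lap}(4/\varepsilon)$ and starts on level $L_0[i]=0$. In round $r=0,1,\dots,g^2-1$, each node $i$ with $L_r[i]=r$ draws a fresh $X\sim\mathrm{Lap}(8/\varepsilon)$, counts the number $\mathcal U_i$ of its neighbors $j$ with $L_r[j]=r$, and releases $A_i=0$ if $\mathcal U_i+X\le(1+\psi)^{\lfloor r/g\rfloor}+\tilde\ell(i)$ and $A_i=1$ otherwise; all other nodes release $A_i=0$. Then $L_{r+1}[i]=L_r[i]+A_i$. Finally, with $\ell'$ the largest level such that $L_{\ell'}[i]=\ell'$, the curator outputs $$\hat k(i)=\tfrac{2+\lambda}{2}\,(1+\psi)^{\max\left(\left\lfloor\frac{\ell'+1}{4\lceil\log_{1+\psi}n\rceil}\right\rfloor-1,\;0\right)} .$$ **Theorem.** Let $\eta>0$ be a constant and run the algorithm with $\eta_0=\min(\eta,5)$. 1. For all $n$ and $\varepsilon>0$ it is $\varepsilon$-local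 edge differentially private. 2. It runs in $O(\log^2 n)$ rounds, with a constant depending only on $\eta$. 3. For every constant $c\ge1$ there are constants $K,C$ depending only on $\eta$ and $c$ such that for all $n\ge2$, all $\varepsilon>0$ and every graph $G$ on $n$ vertices, with probability at least $1-C/n^{c}$ the outputs $\hat k(v)$ are $\left(2+\eta,\;K\max\left(\frac{\log n}{\varepsilon},1\right)\right)$-approximate core numbers of $G$; in particular they are $\left(2+\eta,\,O\left(\frac{\log n}{\varepsilon}\right)\right)$-approximate for $\varepsilon\le\log n$. -/

import Mathlib

open MeasureTheory

noncomputable section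

namespace LEDPCore

/-! ### Core numbers -/

/-- The `k`-core of `G`: the largest vertex set in which every vertex has at least `k` neighbours
(the family of such sets is closed under unions, so the union is the largest one). -/
def kCore {V : Type} (G : SimpleGraph V) (k : ℕ) : Set V :=
  ⋃₀ {S : Set V | ∀ u ∈ S, k ≤ (G.neighborSet u ∩ S).ncard}

/-- The core number of `v`: the largest `k` such that `v` lies in the `k`-core. -/
def coreNumber {V : Type} (G : SimpleGraph V) (v : V) : ℕ :=
  sSup {k : ℕ | v ∈ kCore G k}

/-- `est` is a `(φ, ζ)`-approximation to the core numbers of `G`. -/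
def IsApproxCore {V : Type} (φ ζ : ℝ) (G : SimpleGraph V) (est : V → ℝ) : Prop :=
  ∀ v, (coreNumber G v : ℝ) - ζ ≤ est v ∧ est v ≤ φ * (coreNumber G v : ℝ) + ζ

/-! ### Differential privacy

Randomized algorithms are functions of the input and of a sample point `ω`. All outputs are
discrete, so that events are arbitrary sets of outputs (and have to be measurable events). -/

/-- Two graphs on the same vertex set that differ in exactly one edge. -/
def EdgeNeighboring {V : Type} (G G' : SimpleGraph V) : Prop :=
  (symmDiff G.edgeSet G'.edgeSet).ncard = 1

/-- `A` is an `ε`-differentially private algorithm for the neighbouring relation `nbr`. -/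
def IsDP {I Ω Y : Type} [MeasurableSpace Ω] (nbr : I → I → Prop) (ε : ℝ) (μ : Measure Ω)
    (A : I → Ω → Y) : Prop :=
  (∀ x (E : Set Y), MeasurableSet {ω | A x ω ∈ E}) ∧
  ∀ x x', nbr x x' → ∀ E : Set Y,
    μ {ω | A x ω ∈ E} ≤ ENNReal.ofReal (Real.exp ε) * μ {ω | A x' ω ∈ E}

/-- An `ε`-local randomizer: an `ε`-edge differentially private algorithm whose input is the set of
neighbours of a single node. -/
def IsLocalRandomizer {n : ℕ} {S Y : Type} [MeasurableSpace S] (ε : ℝ) (μ : Measure S)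
    (R : Set (Fin n) → S → Y) : Prop :=
  IsDP (fun a a' => (symmDiff a a').ncard = 1) ε μ R

/-! ### Protocols in the local edge model -/

/-- What the curator announces for one round: the parties that are queried, the randomizer that each
of them has to apply (a function of its neighbourhood and of its private randomness) and the
privacy parameters of the randomizers. -/
structure RoundSpec (n : ℕ) (S Y : Type) where
  parties : Set (Fin n)
  randomizer : Fin n → Set (Fin n) → S → Y
  budget : Fin n → ℝ

/-- One round of a transcript: the announcement together with the outputs of the queried parties. -/
structure RoundRecord (n : ℕ) (S Y : Type) extends RoundSpec n S Y where
  outputs : Fin n → Option Y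

/-- The public record of the rounds played so far, in chronological order. -/
abbrev Transcript (n : ℕ) (S Y : Type) : Type := List (RoundRecord n S Y)

/-- A protocol for `n` nodes. Node `v` holds private randomness (an element of `S` with law
`seedLaw v`, independent of the other nodes), which it keeps during the whole computation. The
curator sees nothing but the transcript; it announces a next round or stops (`none`). -/
structure LocalProtocol (n : ℕ) (S Y : Type) [MeasurableSpace S] where
  seedLaw : Fin n → Measure S
  curator : Transcript n S Y → Option (RoundSpec n S Y)

namespace LocalProtocol

variable {n : ℕ} {S Y : Type} [MeasurableSpace S]

/-- The joint law of the private randomness of all nodes. -/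
def law (P : LocalProtocol n S Y) : Measure (Fin n → S) := Measure.pi P.seedLaw

open Classical in
/-- Playing one announced round: each queried node applies its randomizer to its own neighbourhood
and its own randomness, and the result becomes public. -/
def play (G : SimpleGraph (Fin n)) (ω : Fin n → S) (q : RoundSpec n S Y) : RoundRecord n S Y where
  toRoundSpec := q
  outputs v := if v ∈ q.parties then some (q.randomizer v (G.neighborSet v) (ω v)) else none

/-- The transcript after at most `t` rounds on the graph `G`. -/
def run (P : LocalProtocol n S Y) (G : SimpleGraph (Fin n)) (ω : Fin n → S) :
    ℕ → Transcript n S Y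
  | 0 => []
  | t + 1 =>
    match P.curator (P.run G ω t) with
    | none => P.run G ω t
    | some q => P.run G ω t ++ [play G ω q]

/-- The protocol has always stopped after at most `T` rounds. -/
def HaltsWithin (P : LocalProtocol n S Y) (T : ℕ) : Prop :=
  ∀ G ω, P.curator (P.run G ω T) = none

/-- `ε`-local edge differential privacy: the randomness of the nodes is given by probability
measures, all announced randomizers are local randomizers for the announced privacy parameters, and
the transcript is `ε`-edge differentially private at every time (hence the entire transcript is, for
a protocol that halts). -/
def IsLEDP (P : LocalProtocol n S Y) (ε : ℝ) : Prop :=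
  (∀ v, IsProbabilityMeasure (P.seedLaw v)) ∧
  (∀ π q, P.curator π = some q → ∀ v ∈ q.parties,
    0 ≤ q.budget v ∧ IsLocalRandomizer (q.budget v) (P.seedLaw v) (q.randomizer v)) ∧
  ∀ t, IsDP EdgeNeighboring ε P.law (fun G ω => P.run G ω t)

end LocalProtocol

/-! ### The level algorithm -/

/-- The centered Laplace distribution `Lap(b)`. -/
def laplace (b : ℝ) : Measure ℝ :=
  volume.withDensity (fun x => ENNReal.ofReal (Real.exp (-|x| / b) / (2 * b)))

/-- The parameter `ψ`. -/
def psi (η : ℝ) : ℝ := 0.1 * η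

/-- The parameter `λ`; it satisfies `2 + λ = (2 + η) / (1 + ψ)²`. -/
def lam (η : ℝ) : ℝ := 2 * (30 - η) * η / (η + 10) ^ 2

/-- The number `ℓ = ⌈log_{1+ψ} n⌉`. -/
def logCeil (n : ℕ) (η : ℝ) : ℕ := ⌈Real.logb (1 + psi η) n⌉₊

/-- The number of consecutive levels with the same threshold. -/
def groupSize (n : ℕ) (η : ℝ) : ℕ := 4 * logCeil n η

/-- The number of rounds, `(4ℓ)²`. -/
def numRounds (n : ℕ) (η : ℝ) : ℕ := groupSize n η ^ 2

/-- The threshold `(1+ψ)^⌊r / (4ℓ)⌋` of round `r`. -/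
def threshold (n : ℕ) (η : ℝ) (r : ℕ) : ℝ := (1 + psi η) ^ (r / groupSize n η)

/-- The private randomness of a node: the noise of its threshold and its noises in the rounds. -/
abbrev Seed (n : ℕ) (η : ℝ) : Type := ℝ × (Fin (numRounds n η) → ℝ)

/-- The level of node `i` after the rounds recorded in `π`: the number of rounds in which it
released `1`. In particular, `level (π.take r) i` is the level at the beginning of round `r`. -/
def level {n : ℕ} {S : Type} (π : Transcript n S Bool) (i : Fin n) : ℕ :=
  π.countP (fun e => e.outputs i == some true)

open Classical in
/-- The randomizer of node `i` in round `r = π.length`: if the node is on level `r`, it counts its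
neighbours `j ∈ a` on level `r`, adds noise and releases `1` if the result exceeds its noisy
threshold; otherwise (and whenever it is not on level `r`) it releases `0`. -/
def levelRandomizer (n : ℕ) (η : ℝ) (π : Transcript n (Seed n η) Bool)
    (h : π.length < numRounds n η) (i : Fin n) (a : Set (Fin n)) (s : Seed n η) : Bool :=
  if level π i = π.length then
    decide (threshold n η π.length + s.1 <
      ({j ∈ a | level π j = π.length}.ncard : ℝ) + s.2 ⟨π.length, h⟩)
  else false

/-- The level algorithm as a protocol: threshold noise `Lap(4/ε)`, noise `Lap(8/ε)` in each round,
and all nodes release a bit in each of the rounds `0, …, numRounds n η - 1`. -/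
def kCoreProtocol (n : ℕ) (ε η : ℝ) : LocalProtocol n (Seed n η) Bool where
  seedLaw _ := (laplace (4 / ε)).prod (Measure.pi fun _ => laplace (8 / ε))
  curator π :=
    if h : π.length < numRounds n η then
      some
        { parties := Set.univ
          randomizer := levelRandomizer n η π h
          budget := fun _ => ε }
    else none

/-- The highest level `ℓ'` such that node `i` was on level `ℓ'` at the beginning of round `ℓ'`. -/
def topLevel {n : ℕ} {S : Type} (π : Transcript n S Bool) (i : Fin n) : ℕ :=
  Nat.findGreatest (fun l => level (π.take l) i = l) π.length

/-- The estimate that the curator computes from the final transcript. The truncated subtraction of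
natural numbers is `max (⌊(ℓ'+1) / (4ℓ)⌋ - 1) 0`. -/
def coreEstimate {n : ℕ} {S : Type} (η : ℝ) (π : Transcript n S Bool) (i : Fin n) : ℝ :=
  (2 + lam η) / 2 * (1 + psi η) ^ ((topLevel π i + 1) / (4 * logCeil n η) - 1)

/-- The approximate core numbers that the algorithm outputs on the graph `G`. -/
def kCoreOutput (n : ℕ) (ε η : ℝ) (G : SimpleGraph (Fin n)) (ω : Fin n → Seed n η) : Fin n → ℝ :=
  coreEstimate η ((kCoreProtocol n ε η).run G ω (numRounds n η))

end LEDPCore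

end

noncomputable section

namespace LEDPCore

/-! ### The Laplace distribution -/

/-! Privacy. Fixing a transcript fixes every announcement, so the seeds producing it form a product
set with one factor per node, and its probability is a product (`law_run_eq`). Changing an edge
alters only the factors of its two endpoints. Each node runs a sparse-vector mechanism: it releases
`1` until it stops, then only `0`. Lowering its threshold noise by 1 and the noise of its single
stopping round by 2 carries seeds consistent with one neighbourhood to seeds consistent with an
adjacent one (`shift_mem_consistentSeeds`). The cost is `ε/4 + 2·ε/8 = ε/2` per endpoint, hence `ε`
in total, however many rounds are played.

Utility. If all noises are at most `B`, the survivors form a peeling process with comparison error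
`D = 2B` (`NoisyPeeling`). A `k`-core survives while the threshold is below `k - D`, which bounds
the estimates from below (`kCore_subset`). For the upper bound, let `k` be the core number of `v`.
Outside the `(k+1)`-core the degree sum is at most `2k` per vertex (`sum_ncard_union_kCore_le`). So
if the threshold minus `D` exceeds `2(1+ψ)²k`, each round shrinks the survivors outside that core by
a factor `1+ψ`; one group of rounds removes them all, `v` included. A union bound over the Laplace
tails supplies `B = O(log n / ε)`. -/

lemma measurable_laplace_density (b : ℝ) :
    Measurable fun x : ℝ => ENNReal.ofReal (Real.exp (-|x| / b) / (2 * b)) := by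
  fun_prop

lemma laplace_Ioi {b c : ℝ} (hb : 0 < b) (hc : 0 ≤ c) :
    laplace b (Set.Ioi c) = ENNReal.ofReal (Real.exp (-c / b) / 2) := by
  have hneg : -(1 / b) < 0 := by simpa using hb
  rw [laplace, withDensity_apply _ measurableSet_Ioi]
  have h1 : ∀ x ∈ Set.Ioi c, ENNReal.ofReal (Real.exp (-|x| / b) / (2 * b)) =
      ENNReal.ofReal (Real.exp (-(1 / b) * x) / (2 * b)) := by
    intro x hx
    rw [abs_of_pos (lt_of_le_of_lt hc hx)]
    congr 3
    ring
  rw [setLIntegral_congr_fun measurableSet_Ioi h1, ← ofReal_integral_eq_lintegral_ofReal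
    ((integrableOn_exp_mul_Ioi hneg c).div_const _) (ae_of_all _ fun x => by positivity),
    integral_div, integral_exp_mul_Ioi hneg]
  congr 1
  rw [show -(1 / b) * c = -c / b by ring]
  field_simp

lemma laplace_Iic {b c : ℝ} (hb : 0 < b) (hc : 0 ≤ c) :
    laplace b (Set.Iic (-c)) = ENNReal.ofReal (Real.exp (-c / b) / 2) := by
  have hpos : 0 < 1 / b := by positivity
  rw [laplace, withDensity_apply _ measurableSet_Iic]
  have h1 : ∀ x ∈ Set.Iic (-c), ENNReal.ofReal (Real.exp (-|x| / b) / (2 * b)) =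
      ENNReal.ofReal (Real.exp ((1 / b) * x) / (2 * b)) := by
    intro x hx
    rw [abs_of_nonpos (le_trans hx (by linarith))]
    congr 3
    ring
  rw [setLIntegral_congr_fun measurableSet_Iic h1, ← ofReal_integral_eq_lintegral_ofReal
    ((integrableOn_exp_mul_Iic hpos _).div_const _) (ae_of_all _ fun x => by positivity),
    integral_div, integral_exp_mul_Iic hpos]
  congr 1
  rw [show 1 / b * -c = -c / b by ring]
  field_simp

lemma isProbabilityMeasure_laplace {b : ℝ} (hb : 0 < b) : IsProbabilityMeasure (laplace b) := by
  refine ⟨?_⟩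
  have h := measure_union (μ := laplace b) (Set.Iic_disjoint_Ioi (le_refl (0 : ℝ)))
    measurableSet_Ioi
  rw [Set.Iic_union_Ioi, laplace_Ioi hb le_rfl] at h
  have h2 := laplace_Iic hb (le_refl (0 : ℝ))
  rw [neg_zero] at h2
  rw [h, h2, ← ENNReal.ofReal_add (by positivity) (by positivity)]
  norm_num

lemma laplace_lt_abs_le {b c : ℝ} (hb : 0 < b) (hc : 0 ≤ c) :
    laplace b {x | c < |x|} ≤ ENNReal.ofReal (Real.exp (-c / b)) := by
  have hsub : {x : ℝ | c < |x|} ⊆ Set.Iic (-c) ∪ Set.Ioi c := by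
    intro x hx
    simp only [Set.mem_ofPred_eq] at hx
    rcases lt_abs.1 hx with h | h
    · exact Or.inr h
    · exact Or.inl (by simp only [Set.mem_Iic]; linarith)
  refine (measure_mono hsub).trans ((measure_union_le _ _).trans ?_)
  rw [laplace_Ioi hb hc, laplace_Iic hb hc, ← ENNReal.ofReal_add (by positivity) (by positivity)]
  simp

/-- Translating a Laplace distribution changes probabilities by a bounded factor only. -/
lemma map_sub_laplace_le {b : ℝ} (hb : 0 < b) (d : ℝ) :
    (laplace b).map (fun x => x - d) ≤ ENNReal.ofReal (Real.exp (|d| / b)) • laplace b := by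
  refine Measure.le_iff.2 fun s hs => ?_
  have hm : Measurable fun x : ℝ => x - d := by fun_prop
  have hd := measurable_laplace_density b
  rw [Measure.map_apply hm hs, Measure.smul_apply, smul_eq_mul, laplace,
    withDensity_apply _ (hm hs), withDensity_apply _ hs,
    ← lintegral_const_mul _ hd, ← lintegral_indicator (hm hs), ← lintegral_indicator hs,
    ← lintegral_sub_right_eq_self (s.indicator _) d]
  -- After the translation both integrands live on `x - d ∈ s`, so only the densities at `x` and `x
  -- - d` have to be compared.
  refine lintegral_mono fun x => ?_
  by_cases hx : x - d ∈ s
  · rw [Set.indicator_of_mem hx, Set.indicator_of_mem (show x ∈ (fun x => x - d) ⁻¹' s from hx),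
      ← ENNReal.ofReal_mul (by positivity)]
    refine ENNReal.ofReal_le_ofReal ?_
    rw [← mul_div_assoc, ← Real.exp_add, ← add_div]
    gcongr
    have := abs_sub_abs_le_abs_sub (x - d) x
    have h2 : |x - d - x| = |d| := by rw [show x - d - x = -d by ring, abs_neg]
    linarith
  · rw [Set.indicator_of_notMem hx,
      Set.indicator_of_notMem (show x ∉ (fun x => x - d) ⁻¹' s from hx)]

/-- Coordinatewise domination of finite measures passes to product measures. -/
lemma pi_le_smul_pi {ι : Type} [Fintype ι] {X : ι → Type} [∀ i, MeasurableSpace (X i)]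
    {μ ν : ∀ i, Measure (X i)} [∀ i, SigmaFinite (μ i)] [∀ i, SigmaFinite (ν i)]
    {c : ι → ENNReal} (hc : ∀ i, c i ≠ 0) (hc' : ∀ i, c i ≠ ⊤) (h : ∀ i, μ i ≤ c i • ν i) :
    Measure.pi μ ≤ (∏ i, c i) • Measure.pi ν := by
  have hp0 : (∏ i, c i) ≠ 0 := Finset.prod_ne_zero_iff.2 fun i _ => hc i
  have hpt : (∏ i, c i) ≠ ⊤ := ENNReal.prod_ne_top fun i _ => hc' i
  -- `OuterMeasure.pi` is the largest outer measure bounded on boxes by the product. Checking boxes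
  -- therefore suffices once the constant stands on the left.
  have key : ((∏ i, c i)⁻¹ • Measure.pi μ).toOuterMeasure ≤
      OuterMeasure.pi fun i => (ν i).toOuterMeasure := by
    refine OuterMeasure.le_pi.2 fun s _ => ?_
    change (∏ i, c i)⁻¹ * Measure.pi μ (Set.univ.pi s) ≤ ∏ i, ν i (s i)
    rw [Measure.pi_pi]
    have h2 : ∏ i, μ i (s i) ≤ (∏ i, c i) * ∏ i, ν i (s i) := by
      rw [← Finset.prod_mul_distrib]
      exact Finset.prod_le_prod' fun i _ => h i (s i)
    calc _ ≤ (∏ i, c i)⁻¹ * ((∏ i, c i) * ∏ i, ν i (s i)) := by gcongr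
      _ = _ := by rw [← mul_assoc, ENNReal.inv_mul_cancel hp0 hpt, one_mul]
  refine Measure.le_iff.2 fun s hs => ?_
  have h1 := key s
  rw [← toMeasure_apply _ (Measure.pi_caratheodory ν) hs, ← Measure.pi_def] at h1
  change (∏ i, c i)⁻¹ * Measure.pi μ s ≤ Measure.pi ν s at h1
  rw [Measure.smul_apply, smul_eq_mul]
  calc _ = (∏ i, c i) * ((∏ i, c i)⁻¹ * Measure.pi μ s) := by
        rw [← mul_assoc, ENNReal.mul_inv_cancel hp0 hpt, one_mul]
    _ ≤ _ := by gcongr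

/-- Pure differential privacy of an algorithm with finitely many outputs follows from the inequality
for single outputs. -/
lemma isDP_of_forall_eq {I Ω Y : Type} [MeasurableSpace Ω] {nbr : I → I → Prop} {ε : ℝ}
    {μ : Measure Ω} {A : I → Ω → Y} (hfin : ∀ x, (Set.range (A x)).Finite)
    (hmeas : ∀ x y, MeasurableSet {ω | A x ω = y})
    (hle : ∀ x x', nbr x x' → ∀ y,
      μ {ω | A x ω = y} ≤ ENNReal.ofReal (Real.exp ε) * μ {ω | A x' ω = y}) :
    IsDP nbr ε μ A := by
  have hsplit : ∀ x (E : Set Y) (R : Finset Y), (∀ ω, A x ω ∈ R) →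
      {ω | A x ω ∈ E} = ⋃ y ∈ {y | y ∈ R ∧ y ∈ E}, {ω | A x ω = y} := by
    intro x E R hR
    ext ω
    simp [hR]
  have hfinE : ∀ (E : Set Y) (R : Finset Y), {y | y ∈ R ∧ y ∈ E}.Finite :=
    fun E R => R.finite_toSet.subset fun _ h => h.1
  refine ⟨fun x E => ?_, fun x x' hx E => ?_⟩
  · rw [hsplit x E (hfin x).toFinset (by simp)]
    exact (hfinE _ _).measurableSet_biUnion fun y _ => hmeas x y
  · classical
    let R := (hfin x).toFinset ∪ (hfin x').toFinset
    have hsum : ∀ z, (∀ ω, A z ω ∈ R) → μ {ω | A z ω ∈ E} =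
        ∑ y ∈ (hfinE E R).toFinset, μ {ω | A z ω = y} := by
      intro z hz
      rw [hsplit z E R hz, ← measure_biUnion_finset _ fun y _ => hmeas z y]
      · simp
      · intro y _ y' _ hne
        refine Set.disjoint_left.2 fun ω h h' => hne ?_
        exact Eq.trans (Eq.symm h) h'
    rw [hsum x (by simp [R]), hsum x' (by simp [R]), Finset.mul_sum]
    exact Finset.sum_le_sum fun y _ => hle x x' hx y

namespace LocalProtocol

/-! ### Transcripts of local protocols -/

variable {n : ℕ} {S Y : Type}

/-- The private randomness for which a node `v` with neighbourhood `a` produces the outputs recorded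
in `π`. -/
def consistentSeeds (π : Transcript n S Y) (v : Fin n) (a : Set (Fin n)) : Set S :=
  {s | ∀ e ∈ π, (v ∈ e.parties → e.outputs v = some (e.randomizer v a s)) ∧
    (v ∉ e.parties → e.outputs v = none)}

lemma play_eq_iff (G : SimpleGraph (Fin n)) (ω : Fin n → S) (q : RoundSpec n S Y)
    (e : RoundRecord n S Y) :
    play G ω q = e ↔ e.toRoundSpec = q ∧
      ∀ v, (v ∈ e.parties → e.outputs v = some (e.randomizer v (G.neighborSet v) (ω v))) ∧
        (v ∉ e.parties → e.outputs v = none) := by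
  classical
  obtain ⟨q', o⟩ := e
  constructor
  · intro h
    simp only [play, RoundRecord.mk.injEq] at h
    obtain ⟨rfl, rfl⟩ := h
    refine ⟨rfl, fun v => ⟨fun hv => ?_, fun hv => ?_⟩⟩
    · simp [hv]
    · simp [hv]
  · rintro ⟨rfl, h⟩
    simp only [play, RoundRecord.mk.injEq, true_and]
    funext v
    by_cases hv : v ∈ q'.parties
    · rw [if_pos hv]; exact ((h v).1 hv).symm
    · rw [if_neg hv]; exact ((h v).2 hv).symm

variable [MeasurableSpace S]

/-- The announcements in `π` are those of the curator, and `π` is complete at time `t`. -/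
def IsScheduled (P : LocalProtocol n S Y) (t : ℕ) (π : Transcript n S Y) : Prop :=
  (∀ (r : ℕ) (h : r < π.length), P.curator (π.take r) = some π[r].toRoundSpec) ∧
    (π.length = t ∨ π.length < t ∧ P.curator π = none)

lemma run_succ (P : LocalProtocol n S Y) (G : SimpleGraph (Fin n)) (ω : Fin n → S) (t : ℕ) :
    P.run G ω (t + 1) = match P.curator (P.run G ω t) with
    | none => P.run G ω t
    | some q => P.run G ω t ++ [play G ω q] := rfl

lemma isScheduled_append {P : LocalProtocol n S Y} {t : ℕ} {π : Transcript n S Y}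
    {e : RoundRecord n S Y} (h : P.IsScheduled t π) (he : P.curator π = some e.toRoundSpec) :
    P.IsScheduled (t + 1) (π ++ [e]) := by
  obtain ⟨h1, h2⟩ := h
  have hl : π.length = t := by
    rcases h2 with h2 | h2
    · exact h2
    · rw [h2.2] at he; simp at he
  refine ⟨fun r hr => ?_, Or.inl (by simp [hl])⟩
  rcases Nat.lt_or_ge r π.length with hlt | hge
  · rw [List.take_append_of_le_length hlt.le, List.getElem_append_left hlt]
    exact h1 r hlt
  · have : r = π.length := by simp at hr; omega
    subst this
    simpa using he

lemma IsScheduled.of_append {P : LocalProtocol n S Y} {t : ℕ} {π : Transcript n S Y}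
    {e : RoundRecord n S Y} (h : P.IsScheduled (t + 1) (π ++ [e])) (hl : π.length = t) :
    P.IsScheduled t π ∧ P.curator π = some e.toRoundSpec := by
  refine ⟨⟨fun r hr => ?_, Or.inl hl⟩, ?_⟩
  · have := h.1 r (by simp; omega)
    rwa [List.take_append_of_le_length hr.le, List.getElem_append_left hr] at this
  · simpa using h.1 π.length (by simp)

/-- The transcript is `π` iff the announcements are right and the randomness of every node is
consistent with its outputs. -/
lemma run_eq_iff (P : LocalProtocol n S Y) (G : SimpleGraph (Fin n)) (ω : Fin n → S) (t : ℕ)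
    (π : Transcript n S Y) :
    P.run G ω t = π ↔ P.IsScheduled t π ∧ ∀ v, ω v ∈ consistentSeeds π v (G.neighborSet v) := by
  induction t generalizing π with
  | zero =>
    constructor
    · rintro rfl
      exact ⟨⟨fun r h => by simp [run] at h, Or.inl rfl⟩, by simp [run, consistentSeeds]⟩
    · rintro ⟨⟨_, h⟩, _⟩
      have : π.length = 0 := by omega
      simp [run, List.length_eq_zero_iff.1 this]
  | succ t ih =>
    constructor
    · rintro rfl
      obtain ⟨hs, hc⟩ := (ih _).1 rfl
      rw [run_succ]
      cases hq : P.curator (P.run G ω t) with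
      | none =>
        refine ⟨⟨hs.1, Or.inr ⟨?_, hq⟩⟩, hc⟩
        change (P.run G ω t).length < t + 1
        rcases hs.2 with h | h <;> omega
      | some q =>
        have hp := (play_eq_iff G ω q _).1 rfl
        refine ⟨isScheduled_append hs (hq.trans (by rw [hp.1])), fun v e he => ?_⟩
        rcases List.mem_append.1 he with h | h
        · exact hc v e h
        · rw [List.mem_singleton.1 h]
          exact hp.2 v
    · rintro ⟨hs, hc⟩
      rw [run_succ]
      rcases hs.2 with hl | ⟨hl, hn⟩
      · obtain ⟨π, e, rfl⟩ : ∃ π' e, π = π' ++ [e] :=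
          ⟨π.dropLast, π.getLast (by rintro rfl; simp at hl),
            (List.dropLast_append_getLast _).symm⟩
        obtain ⟨hs', he⟩ := hs.of_append (by simpa using hl)
        rw [(ih π).2 ⟨hs', fun v e' he' => hc v e' (List.mem_append_left _ he')⟩, he]
        change π ++ [play G ω e.toRoundSpec] = π ++ [e]
        rw [(play_eq_iff G ω _ e).2 ⟨rfl, fun v => hc v e (by simp)⟩]
      · have hs' : P.IsScheduled t π := ⟨hs.1, by
          rcases Nat.lt_or_ge π.length t with h | h
          · exact Or.inr ⟨h, hn⟩
          · exact Or.inl (by omega)⟩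
        rw [(ih π).2 ⟨hs', hc⟩, hn]

/-- Announcements range over an infinite type, but each is determined by the preceding transcript;
only the finitely many output vectors branch. -/
lemma finite_range_run [Finite Y] (P : LocalProtocol n S Y) (G : SimpleGraph (Fin n)) (t : ℕ) :
    (Set.range fun ω => P.run G ω t).Finite := by
  induction t with
  | zero => exact (Set.finite_singleton []).subset (by rintro _ ⟨ω, rfl⟩; rfl)
  | succ t ih =>
    let F : Transcript n S Y → (Fin n → Option Y) → Transcript n S Y := fun π o =>
      match P.curator π with
      | none => π
      | some q => π ++ [⟨q, o⟩]
    refine (Set.Finite.image2 F ih (Set.toFinite Set.univ)).subset ?_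
    rintro _ ⟨ω, rfl⟩
    cases hq : P.curator (P.run G ω t) with
    | none => exact ⟨_, ⟨ω, rfl⟩, fun _ => none, trivial, by simp [F, run_succ, hq]⟩
    | some q =>
      exact ⟨_, ⟨ω, rfl⟩, (play G ω q).outputs, trivial, by simp [F, run_succ, hq, play]⟩

/-- The event is a box despite adaptivity: once `π` is fixed, a node's recorded outputs constrain
its own seed only. -/
lemma setOf_run_eq (P : LocalProtocol n S Y) (G : SimpleGraph (Fin n)) {t : ℕ}
    {π : Transcript n S Y} (h : P.IsScheduled t π) :
    {ω | P.run G ω t = π} = Set.univ.pi fun v => consistentSeeds π v (G.neighborSet v) := by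
  ext ω
  simp [run_eq_iff, h]

lemma law_run_eq (P : LocalProtocol n S Y) [∀ v, SigmaFinite (P.seedLaw v)]
    (G : SimpleGraph (Fin n)) {t : ℕ} {π : Transcript n S Y} (h : P.IsScheduled t π) :
    P.law {ω | P.run G ω t = π} = ∏ v, P.seedLaw v (consistentSeeds π v (G.neighborSet v)) := by
  rw [setOf_run_eq P G h, law, Measure.pi_pi]

/-- Differential privacy of the transcript follows from a product inequality for the single
nodes. -/
lemma isDP_run_of_forall [Finite Y] (P : LocalProtocol n S Y)
    [∀ v, SigmaFinite (P.seedLaw v)] (t : ℕ) (ε : ℝ)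
    (hmeas : ∀ π, P.IsScheduled t π → ∀ v a, MeasurableSet (consistentSeeds π v a))
    (hle : ∀ π, P.IsScheduled t π → ∀ G G' : SimpleGraph (Fin n), EdgeNeighboring G G' →
      ∏ v, P.seedLaw v (consistentSeeds π v (G.neighborSet v)) ≤
        ENNReal.ofReal (Real.exp ε) *
          ∏ v, P.seedLaw v (consistentSeeds π v (G'.neighborSet v))) :
    IsDP EdgeNeighboring ε P.law (fun G ω => P.run G ω t) := by
  have hempty : ∀ G π, ¬ P.IsScheduled t π → {ω | P.run G ω t = π} = ∅ := by
    intro G π h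
    ext ω; simp [run_eq_iff, h]
  refine isDP_of_forall_eq (fun G => finite_range_run P G t) (fun G π => ?_)
    fun G G' hG π => ?_
  · by_cases h : P.IsScheduled t π
    · rw [setOf_run_eq P G h]
      exact MeasurableSet.univ_pi fun v => hmeas π h v _
    · rw [hempty G π h]; exact MeasurableSet.empty
  · by_cases h : P.IsScheduled t π
    · rw [law_run_eq P G h, law_run_eq P G' h]
      exact hle π h G G' hG
    · rw [hempty G π h]; simp

end LocalProtocol

open LocalProtocol

/-! ### Privacy of the level algorithm -/

lemma level_le_length {n : ℕ} {S : Type} (π : Transcript n S Bool) (i : Fin n) :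
    level π i ≤ π.length := List.countP_le_length

/-- A node that is on level `r` at the beginning of round `r` has released `1` in all earlier
rounds. -/
lemma outputs_eq_of_level_take {n : ℕ} {S : Type} {π : Transcript n S Bool} {i : Fin n} {r k : ℕ}
    (hr : r ≤ π.length) (hl : level (π.take r) i = r) (hk : k < r) :
    (π[k]'(hk.trans_le hr)).outputs i = some true := by
  have h : level (π.take r) i = (π.take r).length := by simp [hl, hr]
  have h2 := List.countP_eq_length.1 h π[k] (by
    rw [List.mem_take_iff_getElem]
    exact ⟨k, by omega, rfl⟩)
  simpa using h2

/-- The seeds that are consistent with a transcript of the level algorithm. -/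
lemma mem_consistentSeeds_iff {n : ℕ} {ε η : ℝ} {t : ℕ} {π : Transcript n (Seed n η) Bool}
    (hπ : (kCoreProtocol n ε η).IsScheduled t π) (v : Fin n) (a : Set (Fin n)) (s : Seed n η) :
    s ∈ consistentSeeds π v a ↔ ∀ (r : ℕ) (hr : r < π.length) (hN : r < numRounds n η),
      π[r].outputs v = some (if level (π.take r) v = r then
        decide (threshold n η r + s.1 < ((a ∩ {j | level (π.take r) j = r}).ncard : ℝ)
          + s.2 ⟨r, hN⟩) else false) := by
  have key : ∀ (r : ℕ) (hr : r < π.length), ∃ hN : r < numRounds n η,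
      v ∈ π[r].parties ∧ π[r].randomizer v a s = (if level (π.take r) v = r then
        decide (threshold n η r + s.1 < ((a ∩ {j | level (π.take r) j = r}).ncard : ℝ)
          + s.2 ⟨r, hN⟩) else false) := by
    intro r hr
    have h := hπ.1 r hr
    have hlen : (π.take r).length = r := by simp [hr.le]
    simp only [kCoreProtocol] at h
    split at h
    · rename_i hN
      have h' := Option.some.inj h
      refine ⟨by omega, ?_, ?_⟩
      · rw [← h']; trivial
      · rw [← h']
        simp only [levelRandomizer, hlen]
        rfl
    · simp at h
  constructor
  · intro h r hr hN
    obtain ⟨_, h1, h2⟩ := key r hr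
    rw [← h2]
    exact (h _ (List.getElem_mem hr)).1 h1
  · intro h e he
    obtain ⟨r, hr, rfl⟩ := List.getElem_of_mem he
    obtain ⟨hN, h1, h2⟩ := key r hr
    refine ⟨fun _ => ?_, fun h3 => absurd h1 h3⟩
    rw [h2]
    exact h r hr hN

lemma ncard_inter_le_of_symmDiff {n : ℕ} {a a' : Set (Fin n)} (h : (symmDiff a a').ncard = 1)
    (L : Set (Fin n)) : (a ∩ L).ncard ≤ (a' ∩ L).ncard + 1 := by
  rw [← h]
  refine (Set.ncard_le_ncard ?_ (Set.toFinite _)).trans (Set.ncard_union_le _ _)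
  intro x hx
  by_cases hx' : x ∈ a'
  · exact Or.inl ⟨hx', hx.2⟩
  · exact Or.inr (Or.inl ⟨hx.1, hx'⟩)

open Classical in
/-- The shift of the round noises: the noise of the round in which node `v` stops. -/
def stopShift {n : ℕ} {η : ℝ} (π : Transcript n (Seed n η) Bool) (v : Fin n)
    (r : Fin (numRounds n η)) : ℝ :=
  if ∃ h : r.1 < π.length, level (π.take r) v = r ∧ π[r.1].outputs v = some false then 2 else 0

lemma stopShift_nonneg {n : ℕ} {η : ℝ} (π : Transcript n (Seed n η) Bool) (v : Fin n)
    (r : Fin (numRounds n η)) : 0 ≤ stopShift π v r := by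
  unfold stopShift; split <;> norm_num

/-- A node stops at most once: reaching a later stopping round would require an output `1` in the
earlier one. -/
lemma sum_stopShift_le {n : ℕ} {η : ℝ} (π : Transcript n (Seed n η) Bool) (v : Fin n) :
    ∑ r, stopShift π v r ≤ 2 := by
  classical
  by_cases hex : ∃ r : Fin (numRounds n η), ∃ h : r.1 < π.length,
      level (π.take r) v = r ∧ π[r.1].outputs v = some false
  · obtain ⟨r, h1, h2, h3⟩ := hex
    rw [Finset.sum_eq_single r]
    · unfold stopShift; split <;> norm_num
    · intro r' _ hne
      refine if_neg ?_
      rintro ⟨h1', h2', h3'⟩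
      rcases lt_or_gt_of_ne hne with hlt | hlt
      · have := outputs_eq_of_level_take h1.le h2 hlt
        rw [h3'] at this; simp at this
      · have := outputs_eq_of_level_take h1'.le h2' hlt
        rw [h3] at this; simp at this
    · simp
  · push Not at hex
    rw [Finset.sum_eq_zero]
    · norm_num
    · intro r _
      refine if_neg ?_
      rintro ⟨h1, h2, h3⟩
      exact hex r h1 h2 h3

/-- The sparse-vector step. Counts for `a` and `a'` differ by at most 1. Lowering the threshold by 1
preserves every released `1`; in the stopping round the extra 2 pays for that lowering and for the
change of the count. -/
lemma shift_mem_consistentSeeds {n : ℕ} {ε η : ℝ} {t : ℕ} {π : Transcript n (Seed n η) Bool}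
    (hπ : (kCoreProtocol n ε η).IsScheduled t π) (v : Fin n) {a a' : Set (Fin n)}
    (ha : (symmDiff a a').ncard = 1) {s : Seed n η} (hs : s ∈ consistentSeeds π v a) :
    ((s.1 - 1, fun r => s.2 r - stopShift π v r) : Seed n η) ∈ consistentSeeds π v a' := by
  rw [mem_consistentSeeds_iff hπ] at hs ⊢
  intro r hr hN
  have h := hs r hr hN
  by_cases hl : level (π.take r) v = r
  · rw [if_pos hl] at h ⊢
    rw [h]
    set L := {j | level (π.take r) j = r}
    have h1 : ((a ∩ L).ncard : ℝ) ≤ (a' ∩ L).ncard + 1 := by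
      exact_mod_cast ncard_inter_le_of_symmDiff ha L
    have h2 : ((a' ∩ L).ncard : ℝ) ≤ (a ∩ L).ncard + 1 := by
      exact_mod_cast ncard_inter_le_of_symmDiff (symmDiff_comm a a' ▸ ha) L
    congr 1
    by_cases hd : threshold n η r + s.1 < ((a ∩ L).ncard : ℝ) + s.2 ⟨r, hN⟩
    · have h0 : stopShift π v ⟨r, hN⟩ = 0 := by
        refine if_neg ?_
        rintro ⟨_, _, h3⟩
        simp only [hd, decide_true] at h
        rw [h] at h3; simp at h3
      rw [decide_eq_true hd, eq_comm, decide_eq_true_iff]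
      simp only [h0]
      linarith
    · have h0 : stopShift π v ⟨r, hN⟩ = 2 := by
        refine if_pos ⟨hr, hl, ?_⟩
        rw [h, decide_eq_false hd]
      rw [decide_eq_false hd, eq_comm, decide_eq_false_iff_not]
      simp only [h0]
      linarith
  · rw [if_neg hl] at h ⊢
    exact h

lemma measurableSet_consistentSeeds {n : ℕ} {ε η : ℝ} {t : ℕ} {π : Transcript n (Seed n η) Bool}
    (hπ : (kCoreProtocol n ε η).IsScheduled t π) (v : Fin n) (a : Set (Fin n)) :
    MeasurableSet (consistentSeeds π v a) := by
  have : consistentSeeds π v a = ⋂ (r : ℕ) (hr : r < π.length) (hN : r < numRounds n η),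
      {s : Seed n η | π[r].outputs v = some (if level (π.take r) v = r then
        decide (threshold n η r + s.1 < ((a ∩ {j | level (π.take r) j = r}).ncard : ℝ)
          + s.2 ⟨r, hN⟩) else false)} := by
    ext s
    simp only [Set.mem_iInter]
    exact mem_consistentSeeds_iff hπ v a s
  rw [this]
  refine MeasurableSet.iInter fun r => MeasurableSet.iInter fun hr => MeasurableSet.iInter
    fun hN => ?_
  by_cases hl : level (π.take r) v = r
  · simp only [if_pos hl]
    have hm : MeasurableSet {s : Seed n η | threshold n η r + s.1 <
        ((a ∩ {j | level (π.take r) j = r}).ncard : ℝ) + s.2 ⟨r, hN⟩} :=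
      measurableSet_lt (by fun_prop) (by fun_prop)
    have hf : Measurable fun s : Seed n η => decide (threshold n η r + s.1 <
        ((a ∩ {j | level (π.take r) j = r}).ncard : ℝ) + s.2 ⟨r, hN⟩) :=
      measurable_to_bool (by simpa [Set.preimage] using hm)
    exact hf (Set.toFinite {b | π[r].outputs v = some b}).measurableSet
  · simp only [if_neg hl]
    exact MeasurableSet.const _

/-- The law of the private randomness of a node. -/
abbrev seedMeasure (n : ℕ) (ε η : ℝ) : Measure (Seed n η) :=
  (laplace (4 / ε)).prod (Measure.pi fun _ => laplace (8 / ε))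

lemma isProbabilityMeasure_seedMeasure (n : ℕ) {ε : ℝ} (η : ℝ) (hε : 0 < ε) :
    IsProbabilityMeasure (seedMeasure n ε η) := by
  have := isProbabilityMeasure_laplace (b := 4 / ε) (by positivity)
  have := isProbabilityMeasure_laplace (b := 8 / ε) (by positivity)
  infer_instance

/-- The noises are independent, so the costs (shift divided by scale) of the single coordinates add
up in the exponent. -/
lemma map_shift_seedMeasure_le {n : ℕ} {ε η : ℝ} (hε : 0 < ε) (x : ℝ)
    (d : Fin (numRounds n η) → ℝ) :
    (seedMeasure n ε η).map (fun s => (s.1 - x, fun r => s.2 r - d r)) ≤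
      ENNReal.ofReal (Real.exp (ε / 4 * |x| + ε / 8 * ∑ r, |d r|)) • seedMeasure n ε η := by
  have := isProbabilityMeasure_laplace (b := 4 / ε) (by positivity)
  have := isProbabilityMeasure_laplace (b := 8 / ε) (by positivity)
  have hpi : (Measure.pi fun _ : Fin (numRounds n η) => laplace (8 / ε)).map
      (fun y r => y r - d r) ≤
      (∏ r, ENNReal.ofReal (Real.exp (|d r| / (8 / ε)))) •
        Measure.pi fun _ : Fin (numRounds n η) => laplace (8 / ε) := by
    rw [Measure.pi_map_pi (f := fun r x => x - d r) fun r => (by fun_prop)]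
    have : ∀ r, IsProbabilityMeasure ((laplace (8 / ε)).map fun x => x - d r) := fun r =>
      Measure.isProbabilityMeasure_map (by fun_prop)
    exact pi_le_smul_pi (fun r => by simp [Real.exp_pos]) (fun r => by simp)
      fun r => map_sub_laplace_le (by positivity) (d r)
  have hmap := Measure.map_prod_map (laplace (4 / ε))
    (Measure.pi fun _ : Fin (numRounds n η) => laplace (8 / ε))
    (f := fun y => y - x) (g := fun y r => y r - d r) (by fun_prop) (by fun_prop)
  change (seedMeasure n ε η).map (Prod.map (fun y => y - x) (fun y r => y r - d r)) ≤ _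
  rw [← hmap]
  have hfin : ∀ c : ENNReal, SFinite (c • Measure.pi fun _ : Fin (numRounds n η) =>
    laplace (8 / ε)) := fun c => inferInstance
  refine (Measure.prod_mono (map_sub_laplace_le (by positivity) x) hpi).trans ?_
  rw [Measure.prod_smul_left, Measure.prod_smul_right, smul_smul,
    ← ENNReal.ofReal_prod_of_nonneg (fun _ _ => by positivity),
    ← ENNReal.ofReal_mul (by positivity), ← Real.exp_sum, ← Real.exp_add]
  refine le_of_eq ?_
  congr 3
  rw [Finset.mul_sum]
  congr 1
  · field_simp
  · exact Finset.sum_congr rfl fun r _ => by field_simp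

/-- Changing one neighbour of a node changes the probability of its outputs by a factor of at most
`e^(ε/2)`. -/
lemma seedMeasure_consistentSeeds_le {n : ℕ} {ε η : ℝ} (hε : 0 < ε) {t : ℕ}
    {π : Transcript n (Seed n η) Bool} (hπ : (kCoreProtocol n ε η).IsScheduled t π) (v : Fin n)
    {a a' : Set (Fin n)} (ha : (symmDiff a a').ncard = 1) :
    seedMeasure n ε η (consistentSeeds π v a) ≤
      ENNReal.ofReal (Real.exp (ε / 2)) * seedMeasure n ε η (consistentSeeds π v a') := by
  have hmeas := measurableSet_consistentSeeds hπ v a'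
  calc seedMeasure n ε η (consistentSeeds π v a)
      ≤ (seedMeasure n ε η).map (fun s => (s.1 - 1, fun r => s.2 r - stopShift π v r))
          (consistentSeeds π v a') := by
        rw [Measure.map_apply (by fun_prop) hmeas]
        exact measure_mono fun s hs => shift_mem_consistentSeeds hπ v ha hs
    _ ≤ ENNReal.ofReal (Real.exp (ε / 4 * |1| + ε / 8 * ∑ r, |stopShift π v r|)) *
          seedMeasure n ε η (consistentSeeds π v a') :=
        map_shift_seedMeasure_le hε 1 (stopShift π v) _
    -- The exponent is at most `ε/4 · 1 + ε/8 · 2 = ε/2`.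
    _ ≤ _ := by
        gcongr
        have : ∑ r, |stopShift π v r| ≤ 2 := by
          simpa only [abs_of_nonneg (stopShift_nonneg π v _)] using sum_stopShift_le π v
        rw [abs_one]
        nlinarith

lemma EdgeNeighboring.exists_pair {n : ℕ} {G G' : SimpleGraph (Fin n)}
    (h : EdgeNeighboring G G') : ∃ u w : Fin n, u ≠ w ∧
      (symmDiff (G.neighborSet u) (G'.neighborSet u)).ncard = 1 ∧
      (symmDiff (G.neighborSet w) (G'.neighborSet w)).ncard = 1 ∧
      ∀ v, v ≠ u → v ≠ w → G.neighborSet v = G'.neighborSet v := by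
  obtain ⟨e, he⟩ := Set.ncard_eq_one.1 h
  induction e using Sym2.ind with
  | _ u w =>
  have hadj : ∀ x y, (G.Adj x y ∧ ¬ G'.Adj x y ∨ G'.Adj x y ∧ ¬ G.Adj x y) ↔
      s(x, y) = s(u, w) := by
    intro x y
    rw [← Set.mem_singleton_iff, ← he, Set.mem_symmDiff]
    simp
  have hne : u ≠ w := by
    rintro rfl
    have := (hadj u u).2 rfl
    simp at this
  refine ⟨u, w, hne, ?_, ?_, fun v hu hw => ?_⟩
  · rw [Set.ncard_eq_one]
    refine ⟨w, Set.ext fun x => ?_⟩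
    rw [Set.mem_symmDiff]
    simpa [hne] using hadj u x
  · rw [Set.ncard_eq_one]
    refine ⟨u, Set.ext fun x => ?_⟩
    rw [Set.mem_symmDiff]
    have := hadj w x
    rw [Sym2.eq_swap] at this
    simpa [hne.symm] using this
  · ext x
    have := hadj v x
    simp only [Sym2.eq_iff, hu, hw, false_and, or_self, iff_false] at this
    simp only [SimpleGraph.mem_neighborSet]
    tauto

lemma prod_seedMeasure_le {n : ℕ} {ε η : ℝ} (hε : 0 < ε) {t : ℕ}
    {π : Transcript n (Seed n η) Bool} (hπ : (kCoreProtocol n ε η).IsScheduled t π)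
    {G G' : SimpleGraph (Fin n)} (hG : EdgeNeighboring G G') :
    ∏ v, seedMeasure n ε η (consistentSeeds π v (G.neighborSet v)) ≤
      ENNReal.ofReal (Real.exp ε) *
        ∏ v, seedMeasure n ε η (consistentSeeds π v (G'.neighborSet v)) := by
  obtain ⟨u, w, hne, hu, hw, hrest⟩ := hG.exists_pair
  -- Spreading `e^ε` as `e^(ε/2)` over the two endpoints turns the claim into a factor-by-factor
  -- comparison.
  have hc : ENNReal.ofReal (Real.exp ε) =
      ∏ v, if v ∈ ({u, w} : Finset (Fin n)) then ENNReal.ofReal (Real.exp (ε / 2)) else 1 := by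
    rw [Finset.prod_ite_mem, Finset.univ_inter, Finset.prod_const, Finset.card_pair hne, sq,
      ← ENNReal.ofReal_mul (by positivity), ← Real.exp_add]
    congr 2
    ring
  rw [hc, ← Finset.prod_mul_distrib]
  refine Finset.prod_le_prod' fun v _ => ?_
  by_cases hv : v ∈ ({u, w} : Finset (Fin n))
  · rw [if_pos hv]
    refine seedMeasure_consistentSeeds_le hε hπ v ?_
    rcases Finset.mem_insert.1 hv with rfl | hv
    · exact hu
    · rwa [Finset.mem_singleton.1 hv]
  · rw [if_neg hv, one_mul]
    simp only [Finset.mem_insert, Finset.mem_singleton, not_or] at hv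
    rw [hrest v hv.1 hv.2]

lemma isLocalRandomizer_levelRandomizer {n : ℕ} {ε η : ℝ} (hε : 0 < ε)
    (π : Transcript n (Seed n η) Bool) (h : π.length < numRounds n η) (i : Fin n) :
    IsLocalRandomizer ε (seedMeasure n ε η) (levelRandomizer n η π h i) := by
  have hmeas : ∀ a b, MeasurableSet {s | levelRandomizer n η π h i a s = b} := by
    intro a b
    by_cases hl : level π i = π.length
    · simp only [levelRandomizer, if_pos hl]
      have hm : MeasurableSet {s : Seed n η | threshold n η π.length + s.1 <
          ({j ∈ a | level π j = π.length}.ncard : ℝ) + s.2 ⟨π.length, h⟩} :=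
        measurableSet_lt (by fun_prop) (by fun_prop)
      cases b
      · simp only [decide_eq_false_iff_not]
        exact hm.compl
      · simpa only [decide_eq_true_iff] using hm
    · simp only [levelRandomizer, if_neg hl]
      exact MeasurableSet.const _
  refine isDP_of_forall_eq (fun _ => Set.toFinite _) hmeas fun a a' ha b => ?_
  -- A single round makes one comparison, so it is enough to move the threshold noise by 1 in the
  -- direction that favours `b`; this costs only `ε/4`.
  set x : ℝ := if b then 1 else -1 with hx
  calc seedMeasure n ε η {s | levelRandomizer n η π h i a s = b}
      ≤ (seedMeasure n ε η).map (fun s => (s.1 - x, fun r => s.2 r - 0))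
          {s | levelRandomizer n η π h i a' s = b} := by
        rw [Measure.map_apply (by fun_prop) (hmeas a' b)]
        refine measure_mono fun s hs => ?_
        simp only [Set.mem_preimage, Set.mem_ofPred_eq, levelRandomizer] at hs ⊢
        by_cases hl : level π i = π.length
        · rw [if_pos hl] at hs ⊢
          set L := {j | level π j = π.length}
          have h1 : ((a ∩ L).ncard : ℝ) ≤ (a' ∩ L).ncard + 1 := by
            exact_mod_cast ncard_inter_le_of_symmDiff ha L
          have h2 : ((a' ∩ L).ncard : ℝ) ≤ (a ∩ L).ncard + 1 := by
            exact_mod_cast ncard_inter_le_of_symmDiff (symmDiff_comm a a' ▸ ha) L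
          have e : ∀ a : Set (Fin n), {j ∈ a | level π j = π.length} = a ∩ L := fun _ => rfl
          rw [e] at hs ⊢
          cases b
          · rw [decide_eq_false_iff_not] at hs ⊢
            simp only [hx, Bool.false_eq_true, if_false]
            linarith
          · rw [decide_eq_true_iff] at hs ⊢
            simp only [hx, if_true]
            linarith
        · rw [if_neg hl] at hs ⊢
          exact hs
    _ ≤ ENNReal.ofReal (Real.exp (ε / 4 * |x| + ε / 8 * ∑ _r : Fin (numRounds n η), |(0 : ℝ)|)) *
          seedMeasure n ε η {s | levelRandomizer n η π h i a' s = b} :=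
        map_shift_seedMeasure_le hε x (fun _ => 0) _
    _ ≤ _ := by
        gcongr
        have : |x| = 1 := by rw [hx]; split <;> simp
        simp only [this, abs_zero, Finset.sum_const_zero]
        linarith

theorem isLEDP_kCoreProtocol (n : ℕ) {ε : ℝ} (η : ℝ) (hε : 0 < ε) :
    (kCoreProtocol n ε η).IsLEDP ε := by
  have hprob : ∀ v, IsProbabilityMeasure ((kCoreProtocol n ε η).seedLaw v) :=
    fun _ => isProbabilityMeasure_seedMeasure n η hε
  refine ⟨hprob, fun π q hq v _ => ?_, fun t => ?_⟩
  · simp only [kCoreProtocol] at hq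
    split at hq
    · obtain rfl := Option.some.inj hq
      exact ⟨hε.le, isLocalRandomizer_levelRandomizer hε π _ v⟩
    · simp at hq
  · exact isDP_run_of_forall _ t ε (fun π hπ v a => measurableSet_consistentSeeds hπ v a)
      fun π hπ G G' hG => prod_seedMeasure_le hε hπ hG

/-! ### Cores -/

lemma le_ncard_of_mem_kCore {V : Type} [Finite V] {G : SimpleGraph V} {k : ℕ} {u : V}
    (hu : u ∈ kCore G k) : k ≤ (G.neighborSet u ∩ kCore G k).ncard := by
  obtain ⟨S, hS, huS⟩ := hu
  refine (hS u huS).trans (Set.ncard_le_ncard ?_ (Set.toFinite _))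
  exact Set.inter_subset_inter_right _ (Set.subset_sUnion_of_mem hS)

lemma bddAbove_setOf_mem_kCore {V : Type} [Finite V] (G : SimpleGraph V) (v : V) :
    BddAbove {k : ℕ | v ∈ kCore G k} := by
  refine ⟨Nat.card V, fun k hk => ?_⟩
  refine (le_ncard_of_mem_kCore hk).trans ?_
  rw [← Set.ncard_univ]
  exact Set.ncard_le_ncard (Set.subset_univ _) (Set.toFinite _)

lemma mem_kCore_coreNumber {V : Type} [Finite V] (G : SimpleGraph V) (v : V) :
    v ∈ kCore G (coreNumber G v) := by
  refine Nat.sSup_mem (s := {k : ℕ | v ∈ kCore G k}) ⟨0, ?_⟩ (bddAbove_setOf_mem_kCore G v)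
  exact ⟨Set.univ, fun u _ => Nat.zero_le _, trivial⟩

lemma notMem_kCore_coreNumber_succ {V : Type} [Finite V] (G : SimpleGraph V) (v : V) :
    v ∉ kCore G (coreNumber G v + 1) := fun h =>
  absurd (le_csSup (bddAbove_setOf_mem_kCore G v) h) (by
    change ¬ coreNumber G v + 1 ≤ coreNumber G v
    omega)

lemma coreNumber_le_card {V : Type} [Finite V] (G : SimpleGraph V) (v : V) :
    coreNumber G v ≤ Nat.card V := by
  refine (le_ncard_of_mem_kCore (mem_kCore_coreNumber G v)).trans ?_
  rw [← Set.ncard_univ]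
  exact Set.ncard_le_ncard (Set.subset_univ _) (Set.toFinite _)

/-- Vertices outside the `(k+1)`-core can be peeled off one after the other, with at most `k` edges
each. -/
lemma sum_ncard_union_kCore_le {V : Type} [Finite V] [DecidableEq V] (G : SimpleGraph V) (k : ℕ)
    (Q : Finset V) (hQ : ∀ u ∈ Q, u ∉ kCore G (k + 1)) :
    ∑ u ∈ Q, (G.neighborSet u ∩ (Q ∪ kCore G (k + 1))).ncard ≤ 2 * k * Q.card := by
  classical
  induction hm : Q.card generalizing Q with
  | zero => simp [Finset.card_eq_zero.1 hm]
  | succ m ih =>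
    set H := kCore G (k + 1) with hH
    -- Otherwise every vertex of `Q ∪ H` would have `k + 1` neighbours in it, and `Q` would lie in
    -- the core.
    obtain ⟨u, huQ, hu⟩ : ∃ u ∈ Q, (G.neighborSet u ∩ (Q ∪ H)).ncard ≤ k := by
      by_contra! hcon
      obtain ⟨x, hx⟩ : Q.Nonempty := Finset.card_pos.1 (by omega)
      refine hQ x hx ⟨Q ∪ H, ?_, Or.inl hx⟩
      rintro y (hy | hy)
      · exact hcon y hy
      · exact (le_ncard_of_mem_kCore hy).trans (Set.ncard_le_ncard
          (Set.inter_subset_inter_right _ Set.subset_union_right) (Set.toFinite _))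
    have hcard : (Q.erase u).card = m := by rw [Finset.card_erase_of_mem huQ]; omega
    have ih' := ih (Q.erase u) (fun x hx => hQ x (Finset.mem_of_mem_erase hx)) hcard
    have hstep : ∀ x ∈ Q.erase u, (G.neighborSet x ∩ (Q ∪ H)).ncard ≤
        (G.neighborSet x ∩ ((Q.erase u : Finset V) ∪ H)).ncard + if G.Adj u x then 1 else 0 := by
      intro x hx
      by_cases hux : G.Adj u x
      · rw [if_pos hux, ← Set.ncard_singleton u]
        refine (Set.ncard_le_ncard ?_ (Set.toFinite _)).trans (Set.ncard_union_le _ _)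
        rintro y ⟨hy1, hy2⟩
        by_cases hyu : y = u
        · exact Or.inr hyu
        · refine Or.inl ⟨hy1, ?_⟩
          rcases hy2 with h | h
          · exact Or.inl (by simpa [hyu] using h)
          · exact Or.inr h
      · rw [if_neg hux, add_zero]
        refine Set.ncard_le_ncard ?_ (Set.toFinite _)
        rintro y ⟨hy1, hy2⟩
        have hyu : y ≠ u := by
          rintro rfl
          exact hux ((G.mem_neighborSet _ _).1 hy1).symm
        refine ⟨hy1, ?_⟩
        rcases hy2 with h | h
        · exact Or.inl (by simpa [hyu] using h)
        · exact Or.inr h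
    have hadj : (∑ x ∈ Q.erase u, if G.Adj u x then 1 else 0) ≤ k := by
      rw [Finset.sum_boole, Nat.cast_id, ← Set.ncard_coe_finset]
      refine (Set.ncard_le_ncard ?_ (Set.toFinite _)).trans hu
      intro x hx
      simp only [Finset.coe_filter, Finset.mem_erase, Set.mem_ofPred_eq] at hx
      exact ⟨hx.2, Or.inl hx.1.2⟩
    rw [← Finset.add_sum_erase Q _ huQ]
    have := Finset.sum_le_sum hstep
    rw [Finset.sum_add_distrib] at this
    -- Removing `u` costs its own degree and one unit at each of its neighbours in `Q`, at most `k`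
    -- in both cases.
    calc _ ≤ k + (2 * k * m + k) := by
          refine add_le_add hu (this.trans (add_le_add ih' hadj))
      _ = 2 * k * (m + 1) := by ring

/-- If every vertex of `Z'` outside the `(k+1)`-core has more than `d` neighbours in `Z ⊇ Z'`, then
passing from `Z` to `Z'` shrinks the part outside the core by a factor `2k/d`. -/
lemma mul_ncard_sdiff_kCore_le {V : Type} [Finite V] (G : SimpleGraph V) (k : ℕ) {d : ℝ}
    {Z Z' : Set V} (hZ : Z' ⊆ Z)
    (hd : ∀ u ∈ Z', d ≤ ((G.neighborSet u ∩ Z).ncard : ℝ)) :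
    d * ((Z' \ kCore G (k + 1)).ncard : ℝ) ≤ 2 * k * ((Z \ kCore G (k + 1)).ncard : ℝ) := by
  classical
  set H := kCore G (k + 1) with hH
  set Q := (Set.toFinite (Z \ H)).toFinset with hQ
  set Q' := (Set.toFinite (Z' \ H)).toFinset with hQ'
  have hQQ : Q' ⊆ Q := by
    intro x hx
    simp only [hQ, hQ', Set.Finite.mem_toFinset, Set.mem_sdiff] at hx ⊢
    exact ⟨hZ hx.1, hx.2⟩
  have h1 := sum_ncard_union_kCore_le G k Q (by
    intro u hu
    simp only [hQ, Set.Finite.mem_toFinset, Set.mem_sdiff] at hu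
    exact hu.2)
  rw [Set.ncard_eq_toFinset_card _ (Set.toFinite (Z \ H)),
    Set.ncard_eq_toFinset_card _ (Set.toFinite (Z' \ H))]
  -- The degree sum over `Q'` into `Q ∪ H` is squeezed between `d |Q'|` and the peeling bound `2k
  -- |Q|`.
  have h2 : ∑ u ∈ Q', d ≤ ∑ u ∈ Q', ((G.neighborSet u ∩ (Q ∪ H)).ncard : ℝ) := by
    refine Finset.sum_le_sum fun u hu => ?_
    simp only [hQ', Set.Finite.mem_toFinset, Set.mem_sdiff] at hu
    refine (hd u hu.1).trans ?_
    norm_cast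
    refine Set.ncard_le_ncard (Set.inter_subset_inter_right _ ?_) (Set.toFinite _)
    intro x hx
    by_cases hxH : x ∈ H
    · exact Or.inr hxH
    · exact Or.inl (by simp [hQ, hx, hxH])
  have h3 : ∑ u ∈ Q', ((G.neighborSet u ∩ (Q ∪ H)).ncard : ℝ) ≤ 2 * k * Q.card := by
    refine (Finset.sum_le_sum_of_subset_of_nonneg hQQ fun _ _ _ => Nat.cast_nonneg _).trans ?_
    exact_mod_cast h1
  rw [Finset.sum_const, nsmul_eq_mul] at h2
  linarith

/-! ### The parameters -/

lemma psi_pos {η : ℝ} (hη : 0 < η) : 0 < psi η := by unfold psi; positivity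

lemma two_add_lam_mul {η : ℝ} (hη : 0 < η) : (2 + lam η) * (1 + psi η) ^ 2 = 2 + η := by
  unfold lam psi
  have : η + 10 ≠ 0 := by positivity
  field_simp
  ring

/-- By `two_add_lam_mul` this amounts to `2(1+ψ)³ ≤ 2 + η`, which fails for large `η`; hence the cap
at 5. It lets the prefactor of the estimate absorb rounding to a power of `1+ψ`. -/
lemma one_add_psi_le {η : ℝ} (hη : 0 < η) (hη5 : η ≤ 5) : 1 + psi η ≤ (2 + lam η) / 2 := by
  have h := two_add_lam_mul hη
  have hψ := psi_pos hη
  have h1 : 2 * (1 + psi η) * (1 + psi η) ^ 2 ≤ 2 + η := by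
    unfold psi
    nlinarith [mul_nonneg hη.le (sub_nonneg.2 hη5),
      mul_nonneg hη.le (mul_nonneg hη.le (sub_nonneg.2 hη5))]
  rw [← h] at h1
  have := le_of_mul_le_mul_right h1 (by positivity)
  linarith

lemma le_pow_logCeil {n : ℕ} {η : ℝ} (hη : 0 < η) (hn : 0 < n) :
    (n : ℝ) ≤ (1 + psi η) ^ logCeil n η := by
  have hψ := psi_pos hη
  have h : Real.logb (1 + psi η) n ≤ (logCeil n η : ℝ) := Nat.le_ceil _
  rw [Real.logb_le_iff_le_rpow (by linarith) (by exact_mod_cast hn), Real.rpow_natCast] at h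
  exact h

lemma logCeil_pos {n : ℕ} {η : ℝ} (hη : 0 < η) (hn : 2 ≤ n) : 0 < logCeil n η := by
  refine Nat.ceil_pos.2 (Real.logb_pos ?_ ?_)
  · linarith [psi_pos hη]
  · exact_mod_cast hn

/-- The number of rounds is `O(log² n)`. -/
lemma exists_numRounds_le {η : ℝ} (hη : 0 < η) :
    ∃ C : ℝ, 0 ≤ C ∧ ∀ n : ℕ, (numRounds n η : ℝ) ≤ C * Real.log n ^ 2 := by
  have hψ := psi_pos hη
  have hl : 0 < Real.log (1 + psi η) := Real.log_pos (by linarith)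
  have hl2 : 0 < Real.log 2 := Real.log_pos (by norm_num)
  -- The first summand changes the base of the logarithm; the second absorbs the ceiling, since `1 ≤
  -- log n / log 2` for `n ≥ 2`. For `n < 2` there are no rounds.
  refine ⟨(4 * (1 / Real.log (1 + psi η) + 1 / Real.log 2)) ^ 2, by positivity, fun n => ?_⟩
  rw [← mul_pow]
  unfold numRounds groupSize
  push_cast
  rcases Nat.lt_or_ge n 2 with hn | hn
  · have : logCeil n η = 0 := by
      interval_cases n <;> simp [logCeil]
    simp only [this, Nat.cast_zero, mul_zero, zero_pow two_ne_zero]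
    positivity
  · have hlog : Real.log 2 ≤ Real.log n :=
      Real.log_le_log (by norm_num) (by exact_mod_cast hn)
    have h0 : 0 ≤ Real.logb (1 + psi η) n := Real.logb_nonneg (by linarith) (by
      exact_mod_cast (by omega : 1 ≤ n))
    have hc : (logCeil n η : ℝ) ≤ Real.logb (1 + psi η) n + 1 := (Nat.ceil_lt_add_one h0).le
    have h1 : 1 ≤ 1 / Real.log 2 * Real.log n := by
      rw [one_div, inv_mul_eq_div, le_div_iff₀ hl2]
      linarith
    have h2 : Real.logb (1 + psi η) n = 1 / Real.log (1 + psi η) * Real.log n := by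
      rw [Real.logb]; ring
    refine pow_le_pow_left₀ (by positivity) ?_ 2
    rw [mul_assoc]
    refine mul_le_mul_of_nonneg_left ?_ (by norm_num)
    rw [add_mul]
    linarith

/-! ### Utility for bounded noise -/

/-- `W r` is the set of nodes on level `r` at the beginning of round `r` in a run of the level
algorithm in which the noise in each comparison is at most `D`. -/
structure NoisyPeeling {n : ℕ} (η D : ℝ) (G : SimpleGraph (Fin n)) (W : ℕ → Set (Fin n)) :
    Prop where
  zero : W 0 = Set.univ
  subset : ∀ r < numRounds n η, W (r + 1) ⊆ W r
  lt_of_mem : ∀ r < numRounds n η, ∀ i ∈ W (r + 1),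
    threshold n η r - D < ((G.neighborSet i ∩ W r).ncard : ℝ)
  le_of_notMem : ∀ r < numRounds n η, ∀ i ∈ W r, i ∉ W (r + 1) →
    ((G.neighborSet i ∩ W r).ncard : ℝ) ≤ threshold n η r + D

namespace NoisyPeeling

variable {n : ℕ} {η D : ℝ} {G : SimpleGraph (Fin n)} {W : ℕ → Set (Fin n)}

lemma anti (hW : NoisyPeeling η D G W) {r s : ℕ} (hrs : r ≤ s) (hs : s ≤ numRounds n η) :
    W s ⊆ W r := by
  induction s, hrs using Nat.le_induction with
  | base => exact subset_rfl
  | succ s _ ih => exact (hW.subset s hs).trans (ih (by omega))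

/-- While the whole core survives, each of its vertices sees at least `k` surviving neighbours, and
the thresholds before round `(q+1)g`, with `g = groupSize n η`, are at most `(1+ψ)^q < k - D`. No
core vertex can be the first to stop. -/
lemma kCore_subset (hW : NoisyPeeling η D G W) (hη : 0 < η) {k q : ℕ}
    (hq : q + 1 ≤ groupSize n η) (hk : (1 + psi η) ^ q < k - D) :
    kCore G k ⊆ W ((q + 1) * groupSize n η) := by
  have hN : (q + 1) * groupSize n η ≤ numRounds n η := by
    rw [numRounds, sq]; exact Nat.mul_le_mul_right _ hq
  suffices h : ∀ r ≤ (q + 1) * groupSize n η, kCore G k ⊆ W r from h _ le_rfl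
  intro r
  induction r with
  | zero => intro _; rw [hW.zero]; exact Set.subset_univ _
  | succ r ih =>
    intro hr i hi
    by_contra hnot
    have hsub := ih (by omega)
    have h1 := hW.le_of_notMem r (by omega) i (hsub hi) hnot
    have h2 : (k : ℝ) ≤ ((G.neighborSet i ∩ W r).ncard : ℝ) := by
      exact_mod_cast (le_ncard_of_mem_kCore hi).trans (Set.ncard_le_ncard
        (Set.inter_subset_inter_right _ hsub) (Set.toFinite _))
    have h3 : threshold n η r ≤ (1 + psi η) ^ q := by
      refine pow_le_pow_right₀ (by linarith [psi_pos hη]) ?_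
      have : r / groupSize n η < q + 1 := Nat.div_lt_of_lt_mul (by rw [mul_comm]; omega)
      omega
    linarith

/-- The estimate is not much smaller than the core number. -/
lemma coreNumber_sub_le (hW : NoisyPeeling η D G W) (hη : 0 < η) (hη5 : η ≤ 5) (hn : 2 ≤ n)
    (hD : 0 ≤ D) (v : Fin n) {l : ℕ} (hl : ∀ m ≤ numRounds n η, v ∈ W m → m ≤ l) :
    (coreNumber G v : ℝ) - D ≤
      (2 + lam η) / 2 * (1 + psi η) ^ ((l + 1) / groupSize n η - 1) := by
  have hψ := psi_pos hη
  have hlam := one_add_psi_le hη hη5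
  have hg : 0 < groupSize n η := by have := logCeil_pos hη hn; unfold groupSize; omega
  set k := coreNumber G v with hk
  have hkn : (k : ℝ) ≤ n := by
    have := coreNumber_le_card G v
    rw [Nat.card_fin] at this
    exact_mod_cast this
  -- Since `k ≤ n`, the relevant exponent is at most `groupSize n η`, so the round reached below
  -- does not exceed `numRounds n η`.
  have hex : (k : ℝ) - D ≤ (1 + psi η) ^ groupSize n η := by
    have h1 := le_pow_logCeil hη (by omega : 0 < n)
    have h2 : (1 + psi η) ^ logCeil n η ≤ (1 + psi η) ^ groupSize n η :=
      pow_le_pow_right₀ (by linarith) (by unfold groupSize; omega)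
    linarith
  have hex' : ∃ q : ℕ, (k : ℝ) - D ≤ (1 + psi η) ^ q := ⟨_, hex⟩
  have hp1 : 1 ≤ (1 + psi η) ^ ((l + 1) / groupSize n η - 1) := one_le_pow₀ (by linarith)
  -- The least power of `1+ψ` that is at least `k - D`: the core survives the group of the preceding
  -- power, and the lost factor `1+ψ` is repaid by `(2+λ)/2`.
  cases hq : Nat.find hex' with
  | zero =>
    have h := Nat.find_spec hex'
    rw [hq, pow_zero] at h
    nlinarith
  | succ q =>
    have h := Nat.find_spec hex'
    rw [hq] at h
    have hlt : (1 + psi η) ^ q < k - D := not_le.1 (Nat.find_min hex' (by omega))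
    have hqg : q + 1 ≤ groupSize n η := hq ▸ Nat.find_min' hex' hex
    have hmem := hW.kCore_subset hη hqg hlt (mem_kCore_coreNumber G v)
    have hle := hl _ (by rw [numRounds, sq]; exact Nat.mul_le_mul_right _ hqg) hmem
    have hdiv : q + 1 ≤ (l + 1) / groupSize n η := (Nat.le_div_iff_mul_le hg).2 (by omega)
    have hpow : (1 + psi η) ^ q ≤ (1 + psi η) ^ ((l + 1) / groupSize n η - 1) :=
      pow_le_pow_right₀ (by linarith) (by omega)
    calc (k : ℝ) - D ≤ (1 + psi η) * (1 + psi η) ^ q := by rw [← pow_succ']; exact h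
      _ ≤ _ := mul_le_mul hlam hpow (by positivity) (by linarith)

/-- The estimate is not much larger than the core number. -/
lemma estimate_le (hW : NoisyPeeling η D G W) (hη : 0 < η) (hn : 2 ≤ n)
    (hlam : 1 ≤ (2 + lam η) / 2) (v : Fin n) {l : ℕ} (hlN : l ≤ numRounds n η)
    (hv : v ∈ W l) :
    (2 + lam η) / 2 * (1 + psi η) ^ ((l + 1) / groupSize n η - 1) ≤
      (2 + η) * coreNumber G v + (2 + lam η) / 2 * max D 1 := by
  have hψ := psi_pos hη
  have hL := logCeil_pos hη hn
  have hg : groupSize n η = 4 * logCeil n η := rfl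
  have hg0 : 0 < groupSize n η := by omega
  set k := coreNumber G v with hk
  -- Exponent `0` also arises by truncation and says nothing about `k`; the `1` in `max D 1` covers
  -- this case.
  rcases Nat.eq_zero_or_pos ((l + 1) / groupSize n η - 1) with hp | hp
  · rw [hp, pow_zero, mul_one]
    have h1 : (2 + lam η) / 2 * 1 ≤ (2 + lam η) / 2 * max D 1 := by
      gcongr; exact le_max_right _ _
    have h2 : 0 ≤ (2 + η) * (k : ℝ) := by positivity
    linarith
  set p := (l + 1) / groupSize n η - 1 with hpdef
  by_contra! hcon
  -- Because of the `+ 1`, only `groupSize n η - 1` rounds with threshold `(1+ψ)^p` are guaranteed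
  -- to have been survived.
  have hdiv : (p + 1) * groupSize n η ≤ l + 1 := by
    have : p + 1 = (l + 1) / groupSize n η := by omega
    rw [this]; exact Nat.div_mul_le_self _ _
  rw [add_mul, one_mul] at hdiv
  have hd : 2 * (1 + psi η) ^ 2 * k < (1 + psi η) ^ p - D := by
    have hm : D ≤ max D 1 := le_max_left _ _
    rw [← two_add_lam_mul hη] at hcon
    have h2 : (2 + lam η) / 2 * (2 * (1 + psi η) ^ 2 * k + max D 1) <
        (2 + lam η) / 2 * (1 + psi η) ^ p := by linarith
    have := lt_of_mul_lt_mul_left h2 (by linarith)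
    linarith
  set H := kCore G (k + 1) with hH
  have hstep : ∀ s, s + 1 ≤ groupSize n η - 1 →
      (1 + psi η) * ((W (p * groupSize n η + (s + 1)) \ H).ncard : ℝ) ≤
        ((W (p * groupSize n η + s) \ H).ncard : ℝ) := by
    intro s hs
    have hr : p * groupSize n η + s < numRounds n η := by omega
    have hthr : threshold n η (p * groupSize n η + s) = (1 + psi η) ^ p := by
      unfold threshold
      congr 1
      rw [mul_comm, Nat.mul_add_div hg0, Nat.div_eq_of_lt (by omega), add_zero]
    have hmain := mul_ncard_sdiff_kCore_le G k (d := (1 + psi η) ^ p - D)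
      (hW.subset _ hr) (fun u hu => by
        have := hW.lt_of_mem _ hr u hu
        rw [hthr] at this
        exact this.le)
    rw [← hH] at hmain
    change (1 + psi η) * ((W (p * groupSize n η + s + 1) \ H).ncard : ℝ) ≤ _
    generalize ((W (p * groupSize n η + s + 1) \ H).ncard : ℕ) = a' at hmain ⊢
    generalize ((W (p * groupSize n η + s) \ H).ncard : ℕ) = a at hmain ⊢
    rcases Nat.eq_zero_or_pos a' with rfl | ha'
    · simp
    have ha'' : (0 : ℝ) < a' := by exact_mod_cast ha'
    have h1 : 2 * (1 + psi η) ^ 2 * k * a' < 2 * k * a :=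
      (mul_lt_mul_of_pos_right hd ha'').trans_le hmain
    have hk0 : (0 : ℝ) ≤ 2 * k := by positivity
    -- Cancelling `2k` is safe for `k = 0` as well, because the strict inequality `h1` is then
    -- impossible.
    have h2 : (1 + psi η) ^ 2 * a' < a := by
      refine lt_of_mul_lt_mul_left (a := 2 * (k : ℝ)) ?_ hk0
      linarith
    refine le_trans ?_ h2.le
    gcongr
    nlinarith
  have hind : ∀ s ≤ groupSize n η - 1,
      (1 + psi η) ^ s * ((W (p * groupSize n η + s) \ H).ncard : ℝ) ≤ n := by
    intro s
    induction s with
    | zero =>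
      intro _
      rw [pow_zero, one_mul]
      have := Set.ncard_le_ncard (Set.subset_univ (W (p * groupSize n η + 0) \ H))
        (Set.toFinite _)
      rw [Set.ncard_univ, Nat.card_fin] at this
      exact_mod_cast this
    | succ s ih =>
      intro hs
      refine le_trans ?_ (ih (by omega))
      rw [pow_succ, mul_assoc]
      exact mul_le_mul_of_nonneg_left (hstep s hs) (by positivity)
  have hfin := hind (groupSize n η - 1) le_rfl
  have hvm : v ∈ W (p * groupSize n η + (groupSize n η - 1)) \ H :=
    ⟨hW.anti (by omega) hlN hv, notMem_kCore_coreNumber_succ G v⟩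
  have hone : (1 : ℝ) ≤ ((W (p * groupSize n η + (groupSize n η - 1)) \ H).ncard : ℝ) := by
    exact_mod_cast (Set.ncard_pos (Set.toFinite _)).2 ⟨v, hvm⟩
  -- Here `4ℓ - 1 ≥ ℓ + 1` with `ℓ = logCeil n η ≥ 1`. So the total shrinking factor exceeds `n`,
  -- although `v` is still left.
  have hpow : (1 + psi η) ^ (logCeil n η + 1) ≤ (1 + psi η) ^ (groupSize n η - 1) :=
    pow_le_pow_right₀ (by linarith) (by omega)
  have hnle := le_pow_logCeil hη (by omega : 0 < n)
  have hn0 : (0 : ℝ) < n := by exact_mod_cast (by omega : 0 < n)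
  rw [pow_succ] at hpow
  have hpos : 0 < (1 + psi η) ^ (groupSize n η - 1) := by positivity
  nlinarith

end NoisyPeeling

/-! ### Runs of the level algorithm -/

lemma curator_kCoreProtocol {n : ℕ} {ε η : ℝ} (π : Transcript n (Seed n η) Bool)
    (h : π.length < numRounds n η) : (kCoreProtocol n ε η).curator π =
      some { parties := Set.univ
             randomizer := levelRandomizer n η π h
             budget := fun _ => ε } := dif_pos h

section Run

variable {n : ℕ} {ε η : ℝ} (G : SimpleGraph (Fin n)) (ω : Fin n → Seed n η)

lemma length_run (t : ℕ) (ht : t ≤ numRounds n η) :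
    ((kCoreProtocol n ε η).run G ω t).length = t := by
  induction t with
  | zero => rfl
  | succ t ih =>
    have h := ih (by omega)
    have hlt : ((kCoreProtocol n ε η).run G ω t).length < numRounds n η := by omega
    rw [run_succ, curator_kCoreProtocol _ hlt]
    simp [h]

lemma haltsWithin_numRounds (n : ℕ) (ε η : ℝ) :
    (kCoreProtocol n ε η).HaltsWithin (numRounds n η) := by
  intro G ω
  refine dif_neg ?_
  rw [length_run G ω _ le_rfl]
  exact lt_irrefl _

/-- The round played at time `t`. -/
lemma exists_run_succ {t : ℕ} (ht : t < numRounds n η) : ∃ e : RoundRecord n (Seed n η) Bool,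
    (kCoreProtocol n ε η).run G ω (t + 1) = (kCoreProtocol n ε η).run G ω t ++ [e] ∧
    ∀ i, e.outputs i = some (levelRandomizer n η ((kCoreProtocol n ε η).run G ω t)
      (by rwa [length_run G ω t ht.le]) i (G.neighborSet i) (ω i)) := by
  have hlt : ((kCoreProtocol n ε η).run G ω t).length < numRounds n η := by
    rwa [length_run G ω t ht.le]
  refine ⟨_, by rw [run_succ, curator_kCoreProtocol _ hlt], fun i => ?_⟩
  simp [play]

lemma take_run {r t : ℕ} (hrt : r ≤ t) (ht : t ≤ numRounds n η) :
    ((kCoreProtocol n ε η).run G ω t).take r = (kCoreProtocol n ε η).run G ω r := by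
  induction t, hrt using Nat.le_induction with
  | base => exact List.take_of_length_le (by rw [length_run G ω r ht])
  | succ t hrt ih =>
    obtain ⟨e, he, _⟩ := exists_run_succ (ε := ε) G ω ht
    rw [he, List.take_append_of_le_length (by rw [length_run G ω t (by omega)]; exact hrt)]
    exact ih (by omega)

/-- The nodes on level `r` at the beginning of round `r`. -/
def survivors (ε : ℝ) (G : SimpleGraph (Fin n)) (ω : Fin n → Seed n η) (r : ℕ) : Set (Fin n) :=
  {i | level ((kCoreProtocol n ε η).run G ω r) i = r}

/-- A level rises by at most one per round, so level `r + 1` after `r + 1` rounds forces level `r`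
before and a released `1`. -/
lemma mem_survivors_succ_iff {r : ℕ} (hr : r < numRounds n η) (i : Fin n) :
    i ∈ survivors ε G ω (r + 1) ↔ i ∈ survivors ε G ω r ∧ threshold n η r + (ω i).1 <
      ((G.neighborSet i ∩ survivors ε G ω r).ncard : ℝ) + (ω i).2 ⟨r, hr⟩ := by
  obtain ⟨e, he, hout⟩ := exists_run_succ (ε := ε) G ω hr
  have hlen := length_run (ε := ε) G ω r hr.le
  have hle := level_le_length ((kCoreProtocol n ε η).run G ω r) i
  have hlev : level ((kCoreProtocol n ε η).run G ω (r + 1)) i =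
      level ((kCoreProtocol n ε η).run G ω r) i + if e.outputs i = some true then 1 else 0 := by
    rw [he, level, List.countP_append, ← level]
    simp [List.countP_cons]
  have hset : {j ∈ G.neighborSet i | level ((kCoreProtocol n ε η).run G ω r) j = r} =
      G.neighborSet i ∩ survivors ε G ω r := rfl
  change level _ i = r + 1 ↔ level _ i = r ∧ _
  rw [hlev, hout i]
  simp only [levelRandomizer, hlen, hset]
  by_cases hl : level ((kCoreProtocol n ε η).run G ω r) i = r
  · simp [hl]
  · simp only [hl, if_false, false_and, iff_false]
    simp
    omega

/-- Each comparison involves two noises, one on either side, hence `2 * B`. -/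
lemma noisyPeeling_survivors {B : ℝ} (h1 : ∀ i, |(ω i).1| ≤ B) (h2 : ∀ i r, |(ω i).2 r| ≤ B) :
    NoisyPeeling η (2 * B) G (survivors ε G ω) where
  zero := Set.eq_univ_of_forall fun i => rfl
  subset r hr i hi := ((mem_survivors_succ_iff G ω hr i).1 hi).1
  lt_of_mem r hr i hi := by
    have h := ((mem_survivors_succ_iff G ω hr i).1 hi).2
    have ha := abs_le.1 (h1 i)
    have hb := abs_le.1 (h2 i ⟨r, hr⟩)
    linarith [ha.1, hb.2]
  le_of_notMem r hr i hi hni := by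
    have h := not_lt.1 fun h => hni ((mem_survivors_succ_iff G ω hr i).2 ⟨hi, h⟩)
    have ha := abs_le.1 (h1 i)
    have hb := abs_le.1 (h2 i ⟨r, hr⟩)
    linarith [ha.2, hb.1]

lemma topLevel_spec (i : Fin n) :
    let l := topLevel ((kCoreProtocol n ε η).run G ω (numRounds n η)) i
    l ≤ numRounds n η ∧ i ∈ survivors ε G ω l ∧
      ∀ m ≤ numRounds n η, i ∈ survivors ε G ω m → m ≤ l := by
  intro l
  have hlen := length_run (ε := ε) G ω _ (le_refl (numRounds n η))
  have hl : l ≤ numRounds n η := (Nat.findGreatest_le _).trans_eq hlen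
  refine ⟨hl, ?_, fun m hm hmem => Nat.le_findGreatest (by rwa [hlen]) ?_⟩
  · have h : level (((kCoreProtocol n ε η).run G ω (numRounds n η)).take l) i = l :=
      -- Level `0` always satisfies the predicate, so the maximum is a genuine one and not a default
      -- value.
      Nat.findGreatest_spec (P := fun l =>
        level (((kCoreProtocol n ε η).run G ω (numRounds n η)).take l) i = l)
        (Nat.zero_le _) rfl
    rwa [take_run G ω hl le_rfl] at h
  · rw [take_run G ω hm le_rfl]
    exact hmem

/-- The output for bounded noise. -/
lemma isApproxCore_kCoreOutput {η' B : ℝ} (hη : 0 < η) (hη5 : η ≤ 5) (hη' : η ≤ η') (hn : 2 ≤ n)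
    (h1 : ∀ i, |(ω i).1| ≤ B) (h2 : ∀ i r, |(ω i).2 r| ≤ B) :
    IsApproxCore (2 + η') ((2 + lam η) / 2 * max (2 * B) 1) G (kCoreOutput n ε η G ω) := by
  intro v
  have hW := noisyPeeling_survivors (ε := ε) G ω h1 h2
  have hlam := one_add_psi_le hη hη5
  have hψ := psi_pos hη
  have hB : 0 ≤ B := (abs_nonneg _).trans (h1 v)
  obtain ⟨hl1, hl2, hl3⟩ := topLevel_spec (ε := ε) G ω v
  have hlow := hW.coreNumber_sub_le hη hη5 hn (by positivity) v hl3
  have hup := hW.estimate_le hη hn (by linarith) v hl1 hl2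
  constructor
  · refine le_trans ?_ hlow
    have : 2 * B ≤ max (2 * B) 1 := le_max_left _ _
    nlinarith
  · refine hup.trans ?_
    gcongr

end Run

/-! ### Noise bounds -/

/-- Union bound over the noises of one node; the threshold noise has the smaller scale `4/ε`, so the
tail for `8/ε` bounds it too. -/
lemma seedMeasure_noise_le {n : ℕ} {ε η B : ℝ} (hε : 0 < ε) (hB : 0 ≤ B) :
    seedMeasure n ε η ({s | B < |s.1|} ∪ ⋃ r, {s | B < |s.2 r|}) ≤
      ENNReal.ofReal ((1 + numRounds n η) * Real.exp (-(B * ε / 8))) := by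
  have := isProbabilityMeasure_laplace (b := 4 / ε) (by positivity)
  have := isProbabilityMeasure_laplace (b := 8 / ε) (by positivity)
  have hmeas : MeasurableSet {x : ℝ | B < |x|} := measurableSet_lt (by fun_prop) (by fun_prop)
  have h1 : seedMeasure n ε η {s | B < |s.1|} ≤ ENNReal.ofReal (Real.exp (-(B * ε / 8))) := by
    have := (measurePreserving_fst (μ := laplace (4 / ε)) (ν := Measure.pi
      fun _ : Fin (numRounds n η) => laplace (8 / ε))).measure_preimage hmeas.nullMeasurableSet
    refine (this.le.trans (laplace_lt_abs_le (by positivity) hB)).trans ?_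
    refine ENNReal.ofReal_le_ofReal (Real.exp_le_exp.2 ?_)
    rw [div_div_eq_mul_div]
    have : 0 ≤ B * ε := by positivity
    linarith
  have h2 : ∀ r, seedMeasure n ε η {s | B < |s.2 r|} ≤
      ENNReal.ofReal (Real.exp (-(B * ε / 8))) := by
    intro r
    have := ((measurePreserving_eval (fun _ : Fin (numRounds n η) => laplace (8 / ε)) r).comp
      (measurePreserving_snd (μ := laplace (4 / ε)))).measure_preimage hmeas.nullMeasurableSet
    refine (this.le.trans (laplace_lt_abs_le (by positivity) hB)).trans_eq ?_
    rw [div_div_eq_mul_div, neg_mul, neg_div]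
  calc _ ≤ seedMeasure n ε η {s | B < |s.1|} + ∑ r, seedMeasure n ε η {s | B < |s.2 r|} :=
        (measure_union_le _ _).trans (by gcongr; exact measure_iUnion_fintype_le _ _)
    _ ≤ ENNReal.ofReal (Real.exp (-(B * ε / 8))) +
          ∑ _r : Fin (numRounds n η), ENNReal.ofReal (Real.exp (-(B * ε / 8))) :=
        add_le_add h1 (Finset.sum_le_sum fun r _ => h2 r)
    _ = _ := by
        rw [← ENNReal.ofReal_sum_of_nonneg (fun _ _ => by positivity),
          ← ENNReal.ofReal_add (by positivity) (by positivity)]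
        simp [add_mul]

lemma law_noise_le {n : ℕ} {ε η B : ℝ} (hε : 0 < ε) (hB : 0 ≤ B) :
    (kCoreProtocol n ε η).law.real
      (⋃ i, {ω | ω i ∈ {s : Seed n η | B < |s.1|} ∪ ⋃ r, {s | B < |s.2 r|}}) ≤
      n * ((1 + numRounds n η) * Real.exp (-(B * ε / 8))) := by
  have := isProbabilityMeasure_seedMeasure n η hε
  have hmeas : MeasurableSet ({s : Seed n η | B < |s.1|} ∪ ⋃ r, {s | B < |s.2 r|}) :=
    (measurableSet_lt (by fun_prop) (by fun_prop)).union
      (MeasurableSet.iUnion fun r => measurableSet_lt (by fun_prop) (by fun_prop))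
  refine (measureReal_iUnion_fintype_le _).trans ?_
  have h : ∀ i, (kCoreProtocol n ε η).law.real
      {ω | ω i ∈ {s : Seed n η | B < |s.1|} ∪ ⋃ r, {s | B < |s.2 r|}} ≤
      (1 + numRounds n η) * Real.exp (-(B * ε / 8)) := by
    intro i
    refine ENNReal.toReal_le_of_le_ofReal (by positivity) ?_
    have := (measurePreserving_eval (fun _ : Fin n => seedMeasure n ε η) i).measure_preimage
      hmeas.nullMeasurableSet
    exact this.le.trans (seedMeasure_noise_le hε hB)
  refine (Finset.sum_le_sum fun i _ => h i).trans_eq ?_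
  simp

/-- With high probability the outputs are approximate core numbers. -/
theorem exists_isApproxCore {η η' : ℝ} (hη : 0 < η) (hη5 : η ≤ 5) (hη' : η ≤ η') {c : ℝ}
    (hc : 0 ≤ c) : ∃ K C : ℝ, ∀ (n : ℕ) (ε : ℝ), 2 ≤ n → 0 < ε → ∀ G : SimpleGraph (Fin n),
      1 - C / (n : ℝ) ^ c ≤ (kCoreProtocol n ε η).law.real
        {ω | IsApproxCore (2 + η') (K * max (Real.log n / ε) 1) G (kCoreOutput n ε η G ω)} := by
  obtain ⟨C₀, hC₀, hN⟩ := exists_numRounds_le hη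
  have hlam : 1 ≤ (2 + lam η) / 2 := by linarith [one_add_psi_le hη hη5, psi_pos hη]
  refine ⟨(2 + lam η) / 2 * (16 * (c + 3)), 1 + C₀, fun n ε hn hε G => ?_⟩
  have hn1 : (1 : ℝ) ≤ n := by exact_mod_cast (by omega : 1 ≤ n)
  have hn0 : (0 : ℝ) < n := by linarith
  have hlog : 0 ≤ Real.log n := Real.log_nonneg hn1
  -- Each tail becomes `n^(-(c+3))`: one factor `n` pays for the nodes, `n²` for the rounds, and
  -- `n^c` remains.
  set B : ℝ := 8 * (c + 3) * Real.log n / ε with hBdef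
  have hB : 0 ≤ B := by positivity
  have := isProbabilityMeasure_seedMeasure n η hε
  have hprob : IsProbabilityMeasure (kCoreProtocol n ε η).law :=
    inferInstanceAs (IsProbabilityMeasure (Measure.pi fun _ : Fin n => seedMeasure n ε η))
  set bad : Set (Fin n → Seed n η) :=
    ⋃ i, {ω | ω i ∈ {s : Seed n η | B < |s.1|} ∪ ⋃ r, {s | B < |s.2 r|}} with hbad
  have hcover : Set.univ ⊆ {ω | IsApproxCore (2 + η') ((2 + lam η) / 2 * (16 * (c + 3)) *
      max (Real.log n / ε) 1) G (kCoreOutput n ε η G ω)} ∪ bad := by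
    intro ω _
    by_cases hω : ω ∈ bad
    · exact Or.inr hω
    · left
      simp only [hbad, Set.mem_iUnion, Set.mem_ofPred_eq, Set.mem_union, not_exists, not_or,
        not_lt] at hω
      have h := isApproxCore_kCoreOutput (ε := ε) G ω hη hη5 hη' hn (fun i => (hω i).1)
        (fun i => (hω i).2)
      have hz : (2 + lam η) / 2 * max (2 * B) 1 ≤
          (2 + lam η) / 2 * (16 * (c + 3)) * max (Real.log n / ε) 1 := by
        rw [mul_assoc]
        refine mul_le_mul_of_nonneg_left (max_le ?_ ?_) (by linarith)
        · calc 2 * B = 16 * (c + 3) * (Real.log n / ε) := by rw [hBdef]; ring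
            _ ≤ _ := by gcongr; exact le_max_left _ _
        · nlinarith [le_max_right (Real.log n / ε) 1]
      exact fun v => ⟨by linarith [(h v).1], by linarith [(h v).2]⟩
  have hbadle : (kCoreProtocol n ε η).law.real bad ≤ (1 + C₀) / (n : ℝ) ^ c := by
    refine (law_noise_le hε hB).trans ?_
    have hexp : Real.exp (-(B * ε / 8)) = 1 / ((n : ℝ) ^ c * (n : ℝ) ^ 3) := by
      rw [← Real.rpow_natCast, ← Real.rpow_add hn0, one_div, Real.exp_neg,
        Real.rpow_def_of_pos hn0, hBdef]
      congr 2
      push_cast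
      field_simp
    have hnum : (numRounds n η : ℝ) ≤ C₀ * n ^ 2 := by
      refine (hN n).trans ?_
      gcongr
      linarith [Real.log_le_sub_one_of_pos hn0]
    have hsq : (1 : ℝ) ≤ n ^ 2 := one_le_pow₀ hn1
    rw [hexp, ← mul_assoc, mul_one_div, div_le_div_iff₀ (by positivity) (by positivity)]
    calc n * (1 + (numRounds n η : ℝ)) * (n : ℝ) ^ c
        ≤ n * (n ^ 2 + C₀ * n ^ 2) * (n : ℝ) ^ c := by gcongr
      _ = _ := by ring
  have htot := (measureReal_mono (μ := (kCoreProtocol n ε η).law) hcover).trans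
    (measureReal_union_le _ _)
  rw [probReal_univ] at htot
  linarith

end LEDPCore

end

theorem mainTheorem5 (η : ℝ) (hη : 0 < η) :
    (∀ (n : ℕ) (ε : ℝ), 0 < ε → (LEDPCore.kCoreProtocol n ε (min η 5)).IsLEDP ε) ∧
    (∃ C : ℝ, ∀ (n : ℕ) (ε : ℝ), 0 < ε →
      (LEDPCore.kCoreProtocol n ε (min η 5)).HaltsWithin (LEDPCore.numRounds n (min η 5)) ∧
      (LEDPCore.numRounds n (min η 5) : ℝ) ≤ C * Real.log n ^ 2) ∧
    (∀ c : ℝ, 1 ≤ c → ∃ K C : ℝ, ∀ (n : ℕ) (ε : ℝ), 2 ≤ n → 0 < ε →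
      ∀ G : SimpleGraph (Fin n),
        1 - C / (n : ℝ) ^ c ≤
          (LEDPCore.kCoreProtocol n ε (min η 5)).law.real
            {ω | LEDPCore.IsApproxCore (2 + η) (K * max (Real.log n / ε) 1) G
              (LEDPCore.kCoreOutput n ε (min η 5) G ω)}) := by
  -- Running with the smaller parameter `min η 5` only improves the factor, as `2 + min η 5 ≤ 2 +
  -- η`.
  have h0 : 0 < min η 5 := lt_min hη (by norm_num)
  refine ⟨fun n ε hε => LEDPCore.isLEDP_kCoreProtocol n _ hε, ?_, fun c hc =>
    LEDPCore.exists_isApproxCore h0 (min_le_right _ _) (min_le_left _ _) (by linarith)⟩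
  obtain ⟨C, _, hC⟩ := LEDPCore.exists_numRounds_le h0
  exact ⟨C, fun n ε _ => ⟨LEDPCore.haltsWithin_numRounds n ε _, hC n⟩⟩
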